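/- For a topological space $Z$, let $Z^{<\omega}=\bigoplus_{n\in\omega}Z^n$ be the topological sum of all its finite powers, and let $SC_p(Z^{<\omega})$ be the space of all separately continuous functions $f:Z^{<\omega}\to\mathbb R$ (that is, for every $n$ the restriction of $f$ to $Z^n$ is continuous in each variable when the other variables are fixed), endowed with the topology of pointwise convergence. Let $\mathbf{SC}_p(\mathcal M_0^{<\omega})$ be the class of all topological spaces that embed topologically into $SC_p(Z^{<\omega})$ for some separable metrizable space $Z$. Then $\mathbf{SC}_p(\mathcal M_0^{<\omega})$ contains: (1) all cosmic spaces, i.e. all regular Hausdorff spaces $X$ with a countable network (a countable family $\mathcal N$ of subsets of $X$ such that for every $x\in X$ and every open $U\ni x$ there is $N\in\mathcal N$ with $x\in N\subseteq U$); (2) all metrizable spaces of weight at most $\mathfrak c$ (the weight is the smallest cardinality of a base of the topology); (3) all generalized ordered spaces of countable linear weight, i.e. all Hausdorff spaces $X$ endowed with a linear order such that the open order convex subsets of $X$ form a base of the topology of $X$ and such that the order topology on $X$, generated by the open half-intervals $\{x:x<a\}$ and $\{x:x>a\}$, $a\in X$, has weight at most $\aleph_0$. -/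

import Mathlib

open Set Topology TopologicalSpace Cardinal

universe u

/-- A family `N` of subsets of `X` is a network if for every point `x` and every open
neighbourhood `U` of `x` some member of `N` contains `x` and is contained in `U`. -/
def IsNetwork {X : Type u} [TopologicalSpace X] (N : Set (Set X)) : Prop :=
  ∀ (x : X) (U : Set X), IsOpen U → x ∈ U → ∃ A ∈ N, x ∈ A ∧ A ⊆ U

/-- A cosmic space: a regular (Hausdorff) space with a countable network. -/
def IsCosmic (X : Type u) [TopologicalSpace X] : Prop :=
  T3Space X ∧ ∃ N : Set (Set X), N.Countable ∧ IsNetwork N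

/-- The weight of a topological space: the smallest cardinality of a base. -/
noncomputable def weight (X : Type u) [TopologicalSpace X] : Cardinal.{u} :=
  sInf {κ | ∃ B : Set (Set X), IsTopologicalBasis B ∧ #B = κ}

/-- A generalized ordered space: a Hausdorff space with a linear order
such that the open order convex sets form a base of the topology. -/
def IsGOSpace (X : Type u) [LinearOrder X] [TopologicalSpace X] : Prop :=
  T2Space X ∧ IsTopologicalBasis {C : Set X | IsOpen C ∧ C.OrdConnected}

/-- The linear weight of a space with a linear order: the weight of the topology
generated by the open half-intervals of the order. -/
noncomputable def linearWeight (X : Type u) [LinearOrder X] : Cardinal.{u} :=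
  @weight X (Preorder.topology X)

/-- The topological sum of all finite powers of `X` (including the power with exponent `0`). -/
abbrev FinPowers (X : Type u) : Type u := Σ n : ℕ, (Fin n → X)

/-- A function on the sum of the finite powers is separately continuous if its restriction to
each power is continuous in each variable when the other variables are fixed. -/
def SeparatelyContinuous {X : Type u} [TopologicalSpace X] (f : FinPowers X → ℝ) : Prop :=
  ∀ (n : ℕ) (x : Fin n → X) (i : Fin n),
    Continuous fun t : X => f ⟨n, Function.update x i t⟩

/-- The space of separately continuous real functions on the sum of the finite powers of `X`. As
a subtype of a product of copies of `ℝ` it carries the topology of pointwise convergence. -/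
abbrev SCp (X : Type u) [TopologicalSpace X] : Type u :=
  {f : FinPowers X → ℝ // SeparatelyContinuous f}

/-- The class of topological spaces that embed into `SCp Z` for some `Z` in the class `𝒳`. -/
def SCpClass (𝒳 : (Z : Type u) → [TopologicalSpace Z] → Prop)
    (X : Type u) [TopologicalSpace X] : Prop :=
  ∃ (Z : Type u) (_ : TopologicalSpace Z), 𝒳 Z ∧ ∃ e : X → SCp Z, IsEmbedding e

/-- The class of separable metrizable spaces. -/
def SeparableMetrizable (Z : Type u) [TopologicalSpace Z] : Prop :=
  SeparableSpace Z ∧ MetrizableSpace Z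

/-!
Functions of one or two variables already suffice: a sequence of kernels `F n x : Z × Z → ℝ`,
separately continuous on `Z × Z` and continuous in `x`, is placed on the powers `Z ^ (n + 2)` (using
the first two coordinates only), and it embeds `X` as soon as its values generate the topology of
`X` (`sCpClass_of_kernels`). Each class is treated by its own kernels.

* Cosmic spaces. `X` is Lindelöf, hence normal, so that its topology is generated by the continuous
  real functions. Record such a function `f` by its trace: for each member `A` of a countable
  network and each rational interval, whether `f` maps `A` into the interval. The traces form
  a subspace `Z` of a Cantor cube, traces determine functions, and for fixed `x` the value `f x`
  depends continuously on the trace of `f`.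
* Metrizable spaces of weight at most `𝔠`. Such a space has at most `𝔠` points, so a partition of
  unity `ρ` indexed by the points of `X` can be indexed by reals `α i`. There are separately
  continuous functions `diagBump c` on `ℝ × ℝ` with value `1` at `(c, c)` and `0` at the other
  points of the diagonal. The kernel `∑ᶠ i, ρ i x * diagBump (α i) (a, b)` is continuous in `x`
  by local finiteness, and its value at `(α j, α j)` is `ρ j x`. Partitions of unity
  subordinate to the covers by balls of radius `1 / (n + 1)` together generate the topology.
* Generalized ordered spaces. The order topology is metrizable, by a metric `d` say, and the given
  topology is obtained from it by making open the sets `[p, ∞)` and `(-∞, q]` for `p` in some set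
  `L` and `q` in some set `R`. The functions `d (·, z)` give the order topology. The function
  `cutKernel` is separately continuous in two variables `p`, `q`; it is continuous in `x` for the
  order topology when `p ≠ q`, while for `p = q` it is the indicator function of `x < p`, which is
  continuous in `x` when `p ∈ L`. The set `R` is handled by the dual order. The parameter space `Z`
  is made of copies of `L`, `R` and the whole space that are clopen in it.
-/

/-! ### Embeddings given by separately continuous kernels -/

/-- A function on the sum of the finite powers of `Z` obtained from a sequence of functions of two
variables: on `Z ^ (n + 2)` it is the `n`-th function applied to the first two coordinates, and it
vanishes on the powers with exponents `0` and `1`. -/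
def pairExtend {Z : Type u} (h : ℕ → Z → Z → ℝ) : FinPowers Z → ℝ
  | ⟨0, _⟩ => 0
  | ⟨1, _⟩ => 0
  | ⟨n + 2, z⟩ => h n (z 0) (z 1)

theorem separatelyContinuous_pairExtend {Z : Type u} [TopologicalSpace Z] {h : ℕ → Z → Z → ℝ}
    (hl : ∀ n b, Continuous fun a => h n a b) (hr : ∀ n a, Continuous (h n a)) :
    SeparatelyContinuous (pairExtend h) := by
  intro n z i
  match n, z, i with
  | 0, _, i => exact i.elim0
  | 1, _, _ => exact continuous_const
  | n + 2, z, i =>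
    change Continuous fun t => h n (Function.update z i t 0) (Function.update z i t 1)
    by_cases h0 : i = 0
    · subst h0
      simpa using hl n (z 1)
    by_cases h1 : i = 1
    · subst h1
      simpa using hr n (z 0)
    · simpa [Function.update_of_ne (Ne.symm h0), Function.update_of_ne (Ne.symm h1)] using
        continuous_const

/-- A T₀ space embeds into `SCp Z` if there are kernels that are continuous in the variable from
the space, separately continuous in two variables from `Z`, and generate the topology. -/
theorem sCpClass_of_kernels {X Z : Type u} [tX : TopologicalSpace X] [T0Space X]
    [TopologicalSpace Z] (hZ : SeparableMetrizable Z) (F : ℕ → X → Z → Z → ℝ)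
    (hl : ∀ n x b, Continuous fun a => F n x a b) (hr : ∀ n x a, Continuous (F n x a))
    (hX : ∀ n a b, Continuous fun x => F n x a b)
    (hgen : ∀ t : TopologicalSpace X, (∀ n a b, Continuous[t, _] fun x => F n x a b) →
      ∀ (x : X) (U : Set X), IsOpen[tX] U → x ∈ U → ∃ V, IsOpen[t] V ∧ x ∈ V ∧ V ⊆ U) :
    SCpClass SeparableMetrizable X := by
  let e : X → SCp Z := fun x =>
    ⟨pairExtend fun n => F n x, separatelyContinuous_pairExtend (fun n => hl n x) fun n => hr n x⟩
  refine ⟨Z, _, hZ, e, IsInducing.isEmbedding ⟨le_antisymm ?_ ?_⟩⟩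
  · refine continuous_iff_le_induced.1 (Continuous.subtype_mk (continuous_pi ?_) _)
    rintro ⟨_ | _ | n, z⟩
    · exact continuous_const
    · exact continuous_const
    · exact hX n (z 0) (z 1)
  · set t : TopologicalSpace X := TopologicalSpace.induced e inferInstance with ht
    have he : Continuous[t, _] e := continuous_induced_dom
    have hF : ∀ n a b, Continuous[t, _] fun x => F n x a b := by
      intro n a b
      have hev : Continuous fun f : SCp Z => f.1 ⟨n + 2, Fin.cons a fun _ => b⟩ :=
        (continuous_apply _).comp continuous_subtype_val
      exact @Continuous.comp _ _ _ t _ _ _ _ hev he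
    intro U hU
    refine (@isOpen_iff_forall_mem_open X t U).2 fun x hx => ?_
    obtain ⟨V, hV, hxV, hVU⟩ := hgen t hF x U hU hx
    exact ⟨V, hVU, hV, hxV⟩

theorem SeparableMetrizable.of_t3_secondCountable (Z : Type u) [TopologicalSpace Z] [T3Space Z]
    [SecondCountableTopology Z] : SeparableMetrizable Z :=
  ⟨inferInstance, metrizableSpace_of_t3_secondCountable Z⟩

/-! ### Cosmic spaces -/

theorem IsNetwork.lindelofSpace {X : Type u} [TopologicalSpace X] {N : Set (Set X)}
    (hN : IsNetwork N) (hc : N.Countable) : LindelofSpace X := by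
  refine ⟨isLindelof_of_countable_subcover fun {ι} U hUo hU => ?_⟩
  let N' : Set (Set X) := {A ∈ N | ∃ i, A ⊆ U i}
  have hN' : ∀ A : N', ∃ i, A.1 ⊆ U i := fun A => A.2.2
  choose g hg using hN'
  have : Countable N' := (hc.mono (sep_subset _ _)).to_subtype
  refine ⟨range g, countable_range g, fun x hx => ?_⟩
  obtain ⟨i, hi⟩ := mem_iUnion.1 (hU hx)
  obtain ⟨A, hA, hxA, hAU⟩ := hN x (U i) (hUo i) hi
  exact mem_biUnion (mem_range_self ⟨A, hA, i, hAU⟩) (hg _ hxA)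

open Classical in
/-- The trace of a continuous function on a family `N` of sets: it records, for `A ∈ N` and
rationals `p`, `q`, whether the function maps `A` into the interval `(p, q)`. -/
noncomputable def networkTrace {X : Type u} [TopologicalSpace X] (N : Set (Set X))
    (f : C(X, ℝ)) : N × ℚ × ℚ → Bool :=
  fun i => decide (∀ y ∈ i.1.1, f y ∈ Ioo (i.2.1 : ℝ) i.2.2)

theorem IsNetwork.exists_networkTrace {X : Type u} [TopologicalSpace X] {N : Set (Set X)}
    (hN : IsNetwork N) (f : C(X, ℝ)) (x : X) {a b : ℝ} (h : f x ∈ Ioo a b) :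
    ∃ i, networkTrace N f i = true ∧
      ∀ g : C(X, ℝ), networkTrace N g i = true → g x ∈ Ioo a b := by
  obtain ⟨p, hap, hpx⟩ := exists_rat_btwn h.1
  obtain ⟨q, hxq, hqb⟩ := exists_rat_btwn h.2
  obtain ⟨A, hA, hxA, hAf⟩ :=
    hN x (f ⁻¹' Ioo (p : ℝ) q) (isOpen_Ioo.preimage f.continuous) ⟨hpx, hxq⟩
  refine ⟨(⟨A, hA⟩, p, q), by simpa [networkTrace] using fun y hy => hAf hy, fun g hg => ?_⟩
  have hgx : g x ∈ Ioo (p : ℝ) q := by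
    simp only [networkTrace, decide_eq_true_eq] at hg
    exact hg x hxA
  exact ⟨hap.trans hgx.1, hgx.2.trans hqb⟩

theorem IsNetwork.networkTrace_injective {X : Type u} [TopologicalSpace X] {N : Set (Set X)}
    (hN : IsNetwork N) : Function.Injective (networkTrace N) := by
  intro f g hfg
  ext x
  by_contra hne
  have hpos : 0 < |g x - f x| := abs_pos.2 (sub_ne_zero.2 (Ne.symm hne))
  obtain ⟨i, hi, hg⟩ := hN.exists_networkTrace f x
    (a := f x - |g x - f x|) (b := f x + |g x - f x|) ⟨by linarith, by linarith⟩
  have hgx := hg g (hfg ▸ hi)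
  have : |g x - f x| < |g x - f x| := abs_lt.2 ⟨by linarith [hgx.1], by linarith [hgx.2]⟩
  exact lt_irrefl _ this

theorem IsCosmic.sCpClass {X : Type u} [TopologicalSpace X] (hX : IsCosmic X) :
    SCpClass SeparableMetrizable X := by
  obtain ⟨_, N, hNc, hN⟩ := hX
  have := hN.lindelofSpace hNc
  have : NormalSpace X := NormalSpace.of_regularSpace_lindelofSpace
  have : Countable N := hNc.to_subtype
  let Z := range (networkTrace N)
  let fn : Z → C(X, ℝ) := fun z => z.2.choose
  have hfn : ∀ z : Z, networkTrace N (fn z) = z.1 := fun z => z.2.choose_spec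
  have hfn' : ∀ f, fn ⟨networkTrace N f, mem_range_self f⟩ = f := fun f =>
    hN.networkTrace_injective (hfn _)
  have hcont : ∀ x, Continuous fun z => fn z x := by
    refine fun x => continuous_iff_continuousAt.2 fun z => ?_
    refine (nhds_basis_Ioo (fn z x)).tendsto_right_iff.2 fun ab hab => ?_
    obtain ⟨i, hi, hg⟩ := hN.exists_networkTrace (fn z) x (a := ab.1) (b := ab.2) hab
    have hcoord : Continuous fun w : Z => w.1 i :=
      (continuous_apply i).comp continuous_subtype_val
    have hopen : IsOpen {w : Z | w.1 i = true} := (isOpen_discrete {true}).preimage hcoord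
    filter_upwards [hopen.mem_nhds (show z.1 i = true by rw [← hfn z]; exact hi)] with w hw
    exact hg (fn w) (by rw [hfn w]; exact hw)
  have hsep : ∀ (x : X) (U : Set X), IsOpen U → x ∈ U →
      ∃ z, fn z x < 1 ∧ {y | fn z y < 1} ⊆ U := by
    intro x U hU hx
    obtain ⟨f, hf, hfx, hfU⟩ := CompletelyRegularSpace.completely_regular_isOpen x U hU hx
    let f' : C(X, ℝ) := ⟨fun y => f y, continuous_subtype_val.comp hf⟩
    refine ⟨⟨networkTrace N f', mem_range_self f'⟩, ?_⟩
    rw [hfn' f']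
    refine ⟨by simp [f', hfx], fun y hy => ?_⟩
    by_contra hyU
    have : f y = 1 := hfU hyU
    simp [f', this] at hy
  refine sCpClass_of_kernels (Z := Z) (.of_t3_secondCountable Z) (fun _ x a _ => fn a x)
    (fun _ x _ => hcont x) (fun _ _ _ => continuous_const) (fun _ a _ => (fn a).continuous) ?_
  intro t ht x U hU hx
  obtain ⟨z, hzx, hzU⟩ := hsep x U hU hx
  exact ⟨_, @Continuous.isOpen_preimage _ _ t _ _ (ht 0 z z) _ isOpen_Iio, hzx, hzU⟩

/-! ### Metrizable spaces of weight at most the continuum -/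

/-- A separately continuous function on the plane equal to `1` at `(c, c)` and to `0` at the other
points of the diagonal. At `(c, c)` the fraction is `0 / 0 = 0`, which is the right value there
since the fraction vanishes on the rest of the cross through `(c, c)`. -/
noncomputable def diagBump (c a b : ℝ) : ℝ :=
  1 - 2 * (a - c) * (b - c) / ((a - c) ^ 2 + (b - c) ^ 2)

theorem diagBump_comm (c a b : ℝ) : diagBump c a b = diagBump c b a := by
  unfold diagBump
  rw [add_comm, mul_right_comm]

theorem continuous_diagBump_right (c a : ℝ) : Continuous (diagBump c a) := by
  unfold diagBump
  rcases eq_or_ne a c with rfl | h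
  · simpa using continuous_const
  · have : ∀ b : ℝ, (a - c) ^ 2 + (b - c) ^ 2 ≠ 0 := fun b =>
      (add_pos_of_pos_of_nonneg (sq_pos_of_ne_zero (sub_ne_zero.2 h)) (sq_nonneg _)).ne'
    fun_prop (disch := exact this _)

theorem continuous_diagBump_left (c b : ℝ) : Continuous fun a => diagBump c a b := by
  simpa only [diagBump_comm c _ b] using continuous_diagBump_right c b

theorem diagBump_self (c : ℝ) : diagBump c c c = 1 := by simp [diagBump]

theorem diagBump_diag_of_ne {c a : ℝ} (h : c ≠ a) : diagBump c a a = 0 := by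
  have : a - c ≠ 0 := sub_ne_zero.2 h.symm
  unfold diagBump
  field_simp
  ring

theorem exists_isTopologicalBasis_mk_eq_weight (X : Type u) [TopologicalSpace X] :
    ∃ B : Set (Set X), IsTopologicalBasis B ∧ #B = weight X :=
  csInf_mem (s := {κ | ∃ B : Set (Set X), IsTopologicalBasis B ∧ #B = κ})
    ⟨_, _, isTopologicalBasis_opens, rfl⟩

/-- A point is determined by a sequence of basic sets that shrink to it. -/
theorem mk_le_continuum_of_weight_le (X : Type u) [TopologicalSpace X] [MetrizableSpace X]
    (h : weight X ≤ 𝔠) : #X ≤ 𝔠 := by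
  let _ := metrizableSpaceMetric X
  obtain ⟨B, hB, hBc⟩ := exists_isTopologicalBasis_mk_eq_weight X
  have hex : ∀ (x : X) (n : ℕ), ∃ A : B, x ∈ A.1 ∧ A.1 ⊆ Metric.ball x (1 / ((n : ℝ) + 1)) := by
    intro x n
    obtain ⟨A, hA, hxA, hAs⟩ := hB.exists_subset_of_mem_open
      (Metric.mem_ball_self (x := x) Nat.one_div_pos_of_nat) Metric.isOpen_ball
    exact ⟨⟨A, hA⟩, hxA, hAs⟩
  choose g hg hgb using hex
  have hinj : Function.Injective g := by
    intro x y hxy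
    by_contra hne
    obtain ⟨n, hn⟩ := exists_nat_one_div_lt (dist_pos.2 hne)
    have : x ∈ Metric.ball y (1 / ((n : ℝ) + 1)) := hgb y n (hxy ▸ hg x n)
    exact lt_asymm hn this
  calc #X ≤ #(ℕ → B) := mk_le_of_injective hinj
    _ = #B ^ ℵ₀ := by simp
    _ ≤ 𝔠 ^ ℵ₀ := Cardinal.power_le_power_right (hBc ▸ h)
    _ = 𝔠 := continuum_power_aleph0

theorem MetrizableSpace.sCpClass {X : Type u} [TopologicalSpace X] [MetrizableSpace X]
    (h : weight X ≤ 𝔠) : SCpClass SeparableMetrizable X := by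
  let _ := metrizableSpaceMetric X
  have hcard : lift.{0} #X ≤ lift.{u} #ℝ := by
    simpa [mk_real] using mk_le_continuum_of_weight_le X h
  obtain ⟨α⟩ := lift_mk_le'.1 hcard
  have hpart : ∀ n : ℕ, ∃ ρ : PartitionOfUnity X X univ,
      ρ.IsSubordinate fun i => Metric.ball i (1 / ((n : ℝ) + 1)) := fun n =>
    PartitionOfUnity.exists_isSubordinate isClosed_univ _ (fun _ => Metric.isOpen_ball)
      fun x _ => mem_iUnion.2 ⟨x, Metric.mem_ball_self Nat.one_div_pos_of_nat⟩
  choose ρ hρ using hpart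
  let F : ℕ → X → ULift.{u} ℝ → ULift.{u} ℝ → ℝ := fun n x a b =>
    ∑ᶠ i, ρ n i x • diagBump (α i) a.down b.down
  have hfin : ∀ n x a b,
      F n x a b = ∑ i ∈ (ρ n).finsupport x, ρ n i x • diagBump (α i) a.down b.down :=
    fun n x a b => ((ρ n).sum_finsupport_smul_eq_finsum
      fun i _ => diagBump (α i) a.down b.down).symm
  have hdiag : ∀ n x j, F n x ⟨α j⟩ ⟨α j⟩ = ρ n j x := by
    intro n x j
    change ∑ᶠ i, ρ n i x • diagBump (α i) (α j) (α j) = ρ n j x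
    rw [finsum_eq_single _ j, diagBump_self, smul_eq_mul, mul_one]
    intro i hi
    rw [diagBump_diag_of_ne (α.injective.ne hi), smul_zero]
  have hsep : ∀ (x : X) (U : Set X), IsOpen U → x ∈ U →
      ∃ n j, 0 < ρ n j x ∧ {y | 0 < ρ n j y} ⊆ U := by
    intro x U hU hx
    obtain ⟨ε, hε, hball⟩ := Metric.isOpen_iff.1 hU x hx
    obtain ⟨n, hn⟩ := exists_nat_one_div_lt (half_pos hε)
    obtain ⟨j, hj⟩ := (ρ n).exists_pos (mem_univ x)
    -- the support of `ρ n j` contains `x` and lies in a ball of radius less than `ε / 2`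
    have hsupp : ∀ y, 0 < ρ n j y → dist y j < ε / 2 := fun y hy =>
      (Metric.mem_ball.1 (hρ n j (subset_closure hy.ne'))).trans hn
    refine ⟨n, j, hj, fun y hy => hball ?_⟩
    calc dist y x ≤ dist y j + dist x j := dist_triangle_right _ _ _
      _ < ε := by linarith [hsupp y hy, hsupp x hj]
  have : SeparableMetrizable (ULift.{u} ℝ) :=
    ⟨inferInstance, Homeomorph.ulift.isEmbedding.metrizableSpace⟩
  refine sCpClass_of_kernels this F ?_ ?_ ?_ ?_
  · intro n x b
    simp only [hfin, smul_eq_mul]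
    exact continuous_finsetSum _ fun i _ => continuous_const.mul
      ((continuous_diagBump_left (α i) b.down).comp continuous_uliftDown)
  · intro n x a
    simp only [funext (hfin n x a), smul_eq_mul]
    exact continuous_finsetSum _ fun i _ => continuous_const.mul
      ((continuous_diagBump_right (α i) a.down).comp continuous_uliftDown)
  · intro n a b
    exact (ρ n).continuous_finsum_smul fun i x _ => continuousAt_const
  · intro t ht x U hU hx
    obtain ⟨n, j, hj, hjU⟩ := hsep x U hU hx
    have := ht n ⟨α j⟩ ⟨α j⟩
    simp only [hdiag] at this
    exact ⟨_, @Continuous.isOpen_preimage _ _ t _ _ this _ isOpen_Ioi, hj, hjU⟩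

/-! ### Generalized ordered spaces -/

/-- In terms of `m = min p q` and of the distance `D` from `x` to `m`, replaced by `0` if `m ≤ x`,
the kernel is the quotient of `D` by `D + dist p q`. It is separately continuous in `p` and `q`
and restricts on the diagonal to the indicator function of `x < p`; in particular, `0 / 0 = 0` is
the right value. -/
noncomputable def cutKernel {Y : Type u} [LinearOrder Y] [MetricSpace Y] (x p q : Y) : ℝ :=
  dist (min x (min p q)) (min p q) / (dist (min x (min p q)) (min p q) + dist p q)

section CutKernel

variable {Y : Type u} [LinearOrder Y] [MetricSpace Y]

theorem cutKernel_comm (x p q : Y) : cutKernel x p q = cutKernel x q p := by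
  unfold cutKernel
  rw [min_comm p q, dist_comm p q]

theorem cutKernel_self (x p : Y) : cutKernel x p p = if x < p then 1 else 0 := by
  unfold cutKernel
  split_ifs with h
  · simp [min_eq_left h.le, div_self (dist_pos.2 h.ne).ne']
  · simp [min_eq_right (not_lt.1 h)]

variable [OrderTopology Y]

theorem continuous_cutKernel_right (x p : Y) : Continuous (cutKernel x p) := by
  unfold cutKernel
  rcases le_or_gt p x with h | h
  · have : ∀ q, min x (min p q) = min p q := fun q => min_eq_right ((min_le_left _ _).trans h)
    simpa [this] using continuous_const
  · -- the denominator vanishes only if `p = q ≤ x`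
    have hne : ∀ q, dist (min x (min p q)) (min p q) + dist p q ≠ 0 := by
      intro q h0
      have h1 : dist p q = 0 := by
        linarith [dist_nonneg (x := p) (y := q),
          dist_nonneg (x := min x (min p q)) (y := min p q)]
      obtain rfl := dist_eq_zero.1 h1
      simp only [min_self, dist_self, add_zero, dist_eq_zero, min_eq_left h.le] at h0
      exact h.ne h0
    have hm : Continuous fun q => min p q := continuous_const.min continuous_id
    have hD := (continuous_const (y := x)).min hm |>.dist hm
    exact hD.div (hD.add (continuous_const.dist continuous_id)) hne

theorem continuous_cutKernel_left (x q : Y) : Continuous fun p => cutKernel x p q := by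
  simpa only [cutKernel_comm x _ q] using continuous_cutKernel_right x q

theorem continuous_cutKernel_of_ne {p q : Y} (h : p ≠ q) : Continuous fun x => cutKernel x p q := by
  unfold cutKernel
  have hD : Continuous fun x => dist (min x (min p q)) (min p q) :=
    (continuous_id.min continuous_const).dist continuous_const
  exact hD.div (hD.add continuous_const) fun x =>
    (add_pos_of_nonneg_of_pos dist_nonneg (dist_pos.2 h)).ne'

end CutKernel

theorem IsGOSpace.continuous_of_orderTopology {X : Type u} [LinearOrder X] [TopologicalSpace X]
    (hX : IsGOSpace X) {Y : Type u} [LinearOrder Y] [TopologicalSpace Y] [OrderTopology Y]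
    (e : X ≃o Y) : Continuous e := by
  have := hX.1
  -- a convex neighbourhood of `x` that misses `a` lies on one side of `a`
  have hray : ∀ a : X, IsOpen (Iio a) ∧ IsOpen (Ioi a) := by
    intro a
    constructor <;> refine isOpen_iff_forall_mem_open.2 fun x hx => ?_
    · obtain ⟨C, ⟨hCo, hC⟩, hxC, hCa⟩ := hX.2.exists_subset_of_mem_open
        (show x ∈ ({a}ᶜ : Set X) from hx.ne) isOpen_compl_singleton
      refine ⟨C, fun y hy => lt_of_not_ge fun hay => hCa (hC.out hxC hy ⟨le_of_lt hx, hay⟩) rfl,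
        hCo, hxC⟩
    · obtain ⟨C, ⟨hCo, hC⟩, hxC, hCa⟩ := hX.2.exists_subset_of_mem_open
        (show x ∈ ({a}ᶜ : Set X) from hx.ne') isOpen_compl_singleton
      refine ⟨C, fun y hy => lt_of_not_ge fun hya => hCa (hC.out hy hxC ⟨hya, le_of_lt hx⟩) rfl,
        hCo, hxC⟩
  rw [OrderTopology.topology_eq_generate_intervals (α := Y), continuous_generateFrom_iff]
  rintro s ⟨a, rfl | rfl⟩
  · rw [← e.apply_symm_apply a, e.preimage_Ioi]
    exact (hray _).2
  · rw [← e.apply_symm_apply a, e.preimage_Iio]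
    exact (hray _).1

theorem IsClopen.continuous_ite {X : Type u} [TopologicalSpace X] {p : X → Prop} [DecidablePred p]
    (hp : IsClopen {x | p x}) {f g : X → ℝ} (hf : Continuous f) (hg : Continuous g) :
    Continuous fun x => if p x then f x else g x :=
  continuous_if (by simp [hp.frontier_eq]) hf.continuousOn hg.continuousOn

/-- In a space finer than its order topology, a cut kernel of two points, the first of which has
an open upper ray, is continuous in the first variable. -/
theorem continuous_cutKernel_comp {X Y : Type u} [TopologicalSpace X]
    [LinearOrder Y] [MetricSpace Y] [OrderTopology Y] {e : X → Y} (he : Continuous e) {p q : Y}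
    (hp : IsOpen (e ⁻¹' Ici p)) : Continuous fun x => cutKernel (e x) p q := by
  rcases eq_or_ne p q with rfl | h
  · simp only [cutKernel_self]
    have hs : IsClopen {x | e x < p} := by
      refine ⟨⟨?_⟩, isOpen_Iio.preimage he⟩
      rwa [show {x | e x < p} = e ⁻¹' Iio p from rfl, ← preimage_compl, compl_Iio]
    exact hs.continuous_ite continuous_const continuous_const
  · exact (continuous_cutKernel_of_ne h).comp he

/-- A function of two variables from `Y`, placed on the product with itself of the copy number `i`
of `Y` in `Y × Fin 3`, and extended by zero. -/
def copyKernel {Y : Type u} (i : Fin 3) (g : Y → Y → ℝ) (a b : Y × Fin 3) : ℝ :=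
  if a.2 = i ∧ b.2 = i then g a.1 b.1 else 0

theorem copyKernel_mk {Y : Type u} (i : Fin 3) (g : Y → Y → ℝ) (p q : Y) :
    copyKernel i g (p, i) (q, i) = g p q := by
  simp [copyKernel]

theorem copyKernel_swap {Y : Type u} (i : Fin 3) (g : Y → Y → ℝ) (a b : Y × Fin 3) :
    copyKernel i g a b = copyKernel i (fun p q => g q p) b a := by
  simp only [copyKernel, and_comm]

theorem continuous_copyKernel_right {Y : Type u} [TopologicalSpace Y] (i : Fin 3) {g : Y → Y → ℝ}
    (hg : ∀ p, Continuous (g p)) (a : Y × Fin 3) : Continuous (copyKernel i g a) := by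
  have hs : IsClopen {b : Y × Fin 3 | a.2 = i ∧ b.2 = i} :=
    (isClopen_discrete {j : Fin 3 | a.2 = i ∧ j = i}).preimage continuous_snd
  exact hs.continuous_ite ((hg a.1).comp continuous_fst) continuous_const

theorem continuous_copyKernel_left {Y : Type u} [TopologicalSpace Y] (i : Fin 3) {g : Y → Y → ℝ}
    (hg : ∀ q, Continuous fun p => g p q) (b : Y × Fin 3) :
    Continuous fun a => copyKernel i g a b := by
  simpa only [copyKernel_swap i g] using continuous_copyKernel_right i hg b

theorem continuous_copyKernel_comp {X Y : Type u} [TopologicalSpace X] (i : Fin 3)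
    {g : X → Y → Y → ℝ} (a b : Y × Fin 3)
    (hg : a.2 = i → Continuous fun x => g x a.1 b.1) :
    Continuous fun x => copyKernel i (g x) a b := by
  unfold copyKernel
  by_cases h : a.2 = i ∧ b.2 = i
  · simpa only [if_pos h] using hg h.1
  · simpa only [if_neg h] using continuous_const

/-- A convex set around `x` contains the intersection of an upper and a lower ray around `x`. Each
ray is open unless `x` is an endpoint of the convex set on that side, in which case it is the closed
ray from `x`. The predicate `P` stands for openness in some topology. -/
theorem Set.OrdConnected.exists_rays_subset {X : Type u} [LinearOrder X] {C : Set X}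
    (hC : C.OrdConnected) {x : X} (hx : x ∈ C) {P : Set X → Prop}
    (hl : ∀ y, P (Ioi y)) (hr : ∀ y, P (Iio y))
    (hl' : (∀ y ∈ C, x ≤ y) → P (Ici x)) (hr' : (∀ y ∈ C, y ≤ x) → P (Iic x)) :
    ∃ A B, P A ∧ P B ∧ x ∈ A ∩ B ∧ A ∩ B ⊆ C := by
  have hA : ∃ A, P A ∧ x ∈ A ∧ ∀ y ∈ A, y ≤ x → y ∈ C := by
    by_cases h : ∀ y ∈ C, x ≤ y
    · exact ⟨Ici x, hl' h, le_rfl, fun y hy hyx => le_antisymm hyx hy ▸ hx⟩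
    · push Not at h
      obtain ⟨y, hy, hyx⟩ := h
      exact ⟨Ioi y, hl y, hyx, fun w hw hwx => hC.out hy hx ⟨le_of_lt hw, hwx⟩⟩
  have hB : ∃ B, P B ∧ x ∈ B ∧ ∀ y ∈ B, x ≤ y → y ∈ C := by
    by_cases h : ∀ y ∈ C, y ≤ x
    · exact ⟨Iic x, hr' h, le_rfl, fun y hy hxy => le_antisymm hxy hy ▸ hx⟩
    · push Not at h
      obtain ⟨y, hy, hxy⟩ := h
      exact ⟨Iio y, hr y, hxy, fun w hw hxw => hC.out hx hy ⟨hxw, le_of_lt hw⟩⟩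
  obtain ⟨A, hPA, hxA, hAC⟩ := hA
  obtain ⟨B, hPB, hxB, hBC⟩ := hB
  exact ⟨A, B, hPA, hPB, ⟨hxA, hxB⟩, fun y hy =>
    (le_total y x).elim (hAC y hy.1) (hBC y hy.2)⟩

/-- `Y` is a copy of `X` that carries a metric inducing the order topology. -/
theorem IsGOSpace.sCpClass_of_orderIso {X : Type u} [LinearOrder X] [tX : TopologicalSpace X]
    (hX : IsGOSpace X) {Y : Type u} [LinearOrder Y] [MetricSpace Y] [OrderTopology Y]
    [SecondCountableTopology Y] (e : X ≃o Y) : SCpClass SeparableMetrizable X := by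
  have := hX.1
  have he := hX.continuous_of_orderTopology e
  have hIoi : ∀ y : X, e ⁻¹' Ioi (e y) = Ioi y := fun y => by simp
  have hIio : ∀ y : X, e ⁻¹' Iio (e y) = Iio y := fun y => by simp
  have hIci : ∀ y : X, e ⁻¹' Ici (e y) = Ici y := fun y => by simp
  have hIic : ∀ y : X, e ⁻¹' Iic (e y) = Iic y := fun y => by simp
  -- the disjoint union of `Y` and of the sets of points whose upper, or lower, closed ray is open
  let Z : Set (Y × Fin 3) :=
    {z | (z.2 = 1 → IsOpen (e ⁻¹' Ici z.1)) ∧ (z.2 = 2 → IsOpen (e ⁻¹' Iic z.1))}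
  have : OrderTopology Yᵒᵈ := instOrderTopologyOrderDual
  let F : ℕ → X → Z → Z → ℝ
    | 0, x, a, _ => dist (e x) a.1.1
    | 1, x, a, b => copyKernel 1 (cutKernel (e x)) a.1 b.1
    | _ + 2, x, a, b => copyKernel 2 (fun p q =>
        cutKernel (OrderDual.toDual (e x)) (OrderDual.toDual p) (OrderDual.toDual q)) a.1 b.1
  have hdual : Continuous fun x => OrderDual.toDual (e x) := he
  have hnhds : ∀ (x : X) (U : Set X), IsOpen U → x ∈ U → ∃ C ⊆ U, C.OrdConnected ∧ x ∈ C ∧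
      ((∀ y ∈ C, x ≤ y) → IsOpen (e ⁻¹' Ici (e x))) ∧
      ((∀ y ∈ C, y ≤ x) → IsOpen (e ⁻¹' Iic (e x))) := by
    intro x U hU hx
    obtain ⟨C, ⟨hCo, hC⟩, hxC, hCU⟩ := hX.2.exists_subset_of_mem_open hx hU
    refine ⟨C, hCU, hC, hxC, fun h => ?_, fun h => ?_⟩
    · have hCx : Ici x = C ∪ Ioi x := by
        refine Subset.antisymm (fun y hy => ?_) (union_subset h Ioi_subset_Ici_self)
        rcases eq_or_lt_of_le (mem_Ici.1 hy) with rfl | hxy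
        exacts [.inl hxC, .inr hxy]
      rw [hIci, hCx]
      exact hCo.union (hIoi x ▸ isOpen_Ioi.preimage he)
    · have hCx : Iic x = C ∪ Iio x := by
        refine Subset.antisymm (fun y hy => ?_) (union_subset h Iio_subset_Iic_self)
        rcases eq_or_lt_of_le (mem_Iic.1 hy) with rfl | hyx
        exacts [.inl hxC, .inr hyx]
      rw [hIic, hCx]
      exact hCo.union (hIio x ▸ isOpen_Iio.preimage he)
  refine sCpClass_of_kernels (Z := Z) (.of_t3_secondCountable Z) F ?_ ?_ ?_ ?_
  · rintro (_ | _ | n) x b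
    · exact continuous_const.dist (continuous_fst.comp continuous_subtype_val)
    · exact (continuous_copyKernel_left 1 (continuous_cutKernel_left (e x)) b.1).comp
        continuous_subtype_val
    · exact (continuous_copyKernel_left 2 (fun q => continuous_cutKernel_left
        (OrderDual.toDual (e x)) (OrderDual.toDual q)) b.1).comp continuous_subtype_val
  · rintro (_ | _ | n) x a
    · exact continuous_const
    · exact (continuous_copyKernel_right 1 (continuous_cutKernel_right (e x)) a.1).comp
        continuous_subtype_val
    · exact (continuous_copyKernel_right 2 (fun p => continuous_cutKernel_right
        (OrderDual.toDual (e x)) (OrderDual.toDual p)) a.1).comp continuous_subtype_val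
  · rintro (_ | _ | n) a b
    · exact he.dist continuous_const
    · exact continuous_copyKernel_comp 1 a.1 b.1 fun h => continuous_cutKernel_comp he (a.2.1 h)
    · exact continuous_copyKernel_comp 2 a.1 b.1 fun h =>
        continuous_cutKernel_comp hdual (a.2.2 h)
  · intro t ht x U hU hx
    obtain ⟨C, hCU, hC, hxC, hlow, hupp⟩ := hnhds x U hU hx
    have het : Continuous[t, _] e := by
      refine @continuous_iff_continuousAt _ _ t _ _ |>.2 fun w => ?_
      refine tendsto_iff_dist_tendsto_zero.2 ?_
      have := ht 0 ⟨(e w, 0), by simp [Z]⟩ ⟨(e w, 0), by simp [Z]⟩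
      simpa [F] using @Continuous.tendsto _ _ t _ _ this w
    have hl : ∀ y, IsOpen[t] (Ioi y) := fun y =>
      hIoi y ▸ @Continuous.isOpen_preimage _ _ t _ _ het _ isOpen_Ioi
    have hr : ∀ y, IsOpen[t] (Iio y) := fun y =>
      hIio y ▸ @Continuous.isOpen_preimage _ _ t _ _ het _ isOpen_Iio
    -- the cut kernel on the diagonal is less than `1` exactly on the closed ray
    have hl' : (∀ y ∈ C, x ≤ y) → IsOpen[t] (Ici x) := by
      intro h
      let z : Z := ⟨(e x, 1), fun _ => hlow h, by simp⟩
      have := @Continuous.isOpen_preimage _ _ t _ _ (ht 1 z z) _ (isOpen_Iio (a := 1))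
      convert this using 1
      ext w
      by_cases hw : w < x <;>
        simp [F, z, copyKernel_mk, cutKernel_self, hw, not_le.2, not_lt.1]
    have hr' : (∀ y ∈ C, y ≤ x) → IsOpen[t] (Iic x) := by
      intro h
      let z : Z := ⟨(e x, 2), by simp, fun _ => hupp h⟩
      have := @Continuous.isOpen_preimage _ _ t _ _ (ht 2 z z) _ (isOpen_Iio (a := 1))
      convert this using 1
      ext w
      by_cases hw : x < w <;>
        simp [F, z, copyKernel_mk, cutKernel_self, hw, not_le.2, not_lt.1]
    obtain ⟨A, B, hA, hB, hxAB, hABC⟩ := hC.exists_rays_subset hxC hl hr hl' hr'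
    exact ⟨A ∩ B, @IsOpen.inter _ t _ _ hA hB, hxAB, hABC.trans hCU⟩

theorem IsGOSpace.sCpClass {X : Type u} [LinearOrder X] [tX : TopologicalSpace X]
    (hX : IsGOSpace X) (h : linearWeight X ≤ ℵ₀) : SCpClass SeparableMetrizable X := by
  let tO : TopologicalSpace X := Preorder.topology X
  have : @OrderTopology X tO _ := @OrderTopology.mk X tO _ rfl
  obtain ⟨B, hB, hBc⟩ := @exists_isTopologicalBasis_mk_eq_weight X tO
  have hsc : @SecondCountableTopology X tO :=
    @IsTopologicalBasis.secondCountableTopology X tO B hB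
      (le_aleph0_iff_set_countable.1 (hBc.trans_le h))
  have hm : @MetrizableSpace X tO := @metrizableSpace_of_t3_secondCountable X tO
    (@T4Space.t3Space X tO (@T5Space.toT4Space X tO _)) hsc
  exact @IsGOSpace.sCpClass_of_orderIso X _ tX hX X _ (@metrizableSpaceMetric X tO hm) this hsc
    (OrderIso.refl X)

theorem theorem3 :
    (∀ (X : Type u) [TopologicalSpace X],
      IsCosmic X → SCpClass SeparableMetrizable X) ∧
    (∀ (X : Type u) [TopologicalSpace X],
      MetrizableSpace X → weight X ≤ 𝔠 → SCpClass SeparableMetrizable X) ∧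
    (∀ (X : Type u) [LinearOrder X] [TopologicalSpace X],
      IsGOSpace X → linearWeight X ≤ ℵ₀ → SCpClass SeparableMetrizable X) :=
  ⟨fun _ _ hX => hX.sCpClass, fun _ _ _ h => MetrizableSpace.sCpClass h,
    fun _ _ _ hX h => hX.sCpClass h⟩
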